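/- **Theorem.** For $k\ge 7$ let $f_k:\{0,1\}^{2^k}\to\{0,1\}$ be the function of $X=(x_0,\dots,x_{2^k-1})$ that is the conjunction of three $k$-bit equality checks, $$f_k(X)=1\iff Y_0=Z_0\ \wedge\ Y_1=Z_1\ \wedge\ Y_2=Z_2,$$ where, for $i=0,1,2$ and $c_0=\tfrac12\cdot 2^k$, $c_1=\tfrac58\cdot 2^k$, $c_2=\tfrac34\cdot 2^k$, $$Y_i=(x_{c_i-k},\dots,x_{c_i-1}),\qquad Z_i=(x_{c_i},\dots,x_{c_i+k-1}).$$ Let $B$ be the quasi-reduced ordered BDD for $f_k$ (maximally shared, no ply skipped) and let $C$ be the level-$k$ CFLOBDD for $f_k$ (the hierarchical diagram that satisfies the CFLOBDD structural invariants), both for the variable order $x_0,x_1,\dots,x_{2^k-1}$. Let $|B|$ be the number of nodes of $B$, and let $|G(C)|$, $|V(C)|$, $|E(C)|$ be the numbers of groupings, of vertices and of edges of $C$. Vertices and edges of level-$0$ groupings, value edges and terminal values of $C$ are not counted; call and return edges belong to the calling grouping. Then $B$ and $C$ exist, and, with absolute implied constants valid for all $k\ge7$, $$|B|=\Theta(2^k),$$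 $$|G(C)|=\Omega(k\cdot 2^k)\quad\text{and}\quad |G(C)|=\Omega(|B|\log|B|),$$ $$|V(C)|=\Omega(2^{2k})\quad\text{and}\quad |V(C)|=\Omega(|B|^2),$$ $$|E(C)|=\Omega(2^{3k})\quad\text{and}\quad |E(C)|=\Omega(|B|^3).$$ So the upper bounds $O(|B|\log|B|)$, $O(|B|^2)$ and $O(|B|^3)$ on the numbers of groupings, vertices and edges of a CFLOBDD cannot be improved by more than a constant factor. -/

import Mathlib

namespace DD

/-! ### Quasi-reduced (multi-terminal) BDDs -/

/-- A quasi-reduced ordered BDD over the Boolean variables `x_0, …, x_{n-1}`, in this order, with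
terminal values in `V`: no ply is skipped, so every path from the root to a terminal has length `n`.
The maximally shared DAG is represented by the term that it unfolds to: equal sub-terms are one and
the same node of the DAG (see `BDD.nodes`). -/
inductive BDD (V : Type) : ℕ → Type
  | terminal (v : V) : BDD V 0
  | node {n : ℕ} (lo hi : BDD V n) : BDD V (n + 1)

namespace BDD

variable {V : Type}

/-- The interpretation of an assignment: from the root, take the `lo` successor for `0` (`false`)
and the `hi` successor for `1` (`true`), until a terminal is reached. -/
def eval : {n : ℕ} → BDD V n → (Fin n → Bool) → V
  | _, terminal v, _ => v
  | _, node lo hi, x => if x 0 then hi.eval (Fin.tail x) else lo.eval (Fin.tail x)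

/-- `B` is a BDD for the function `f`. -/
def Represents {n : ℕ} (B : BDD V n) (f : (Fin n → Bool) → V) : Prop :=
  ∀ x, B.eval x = f x

open Classical in
/-- The nodes (terminals included) of the shared DAG: the distinct sub-terms. The first component
is the number of variables that remain to be read at the node. -/
noncomputable def nodes : {n : ℕ} → BDD V n → Finset (Σ m : ℕ, BDD V m)
  | _, terminal v => {⟨0, terminal v⟩}
  | _, node lo hi => insert ⟨_, node lo hi⟩ (lo.nodes ∪ hi.nodes)

/-- The size `|B|`: the number of nodes. -/
noncomputable def size {n : ℕ} (B : BDD V n) : ℕ := B.nodes.card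

end BDD

/-! ### CFLOBDDs -/

/-- The first half of an assignment to `2 ^ (l + 1)` variables. -/
def firstHalf {l : ℕ} (x : Fin (2 ^ (l + 1)) → Bool) : Fin (2 ^ l) → Bool :=
  fun i => x ⟨i, by have := i.isLt; rw [pow_succ]; omega⟩

/-- The second half of an assignment to `2 ^ (l + 1)` variables. -/
def secondHalf {l : ℕ} (x : Fin (2 ^ (l + 1)) → Bool) : Fin (2 ^ l) → Bool :=
  fun i => x ⟨2 ^ l + i, by have := i.isLt; rw [pow_succ]; omega⟩

/-- `MockProto l e`: mock-proto-CFLOBDDs whose head is a level-`l` grouping with `e` exit vertices,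
the vertices of each kind being numbered from `0`.
A level-`0` grouping is a don't-care grouping or a fork grouping. A level-`(l + 1)` grouping with
`m` middle vertices and `e` exit vertices has
* an A-connection: a call to `a` together with the return edges `aRet`, from the exit vertices of
  `a` to the middle vertices;
* for each middle vertex `j`, a B-connection: a call to `b j` together with the return edges
  `bRet j`, from the exit vertices of `b j` to the exit vertices. -/
inductive MockProto : ℕ → ℕ → Type
  | dontCare : MockProto 0 1
  | fork : MockProto 0 2
  | grouping {l ea m e : ℕ} (a : MockProto l ea) (aRet : Fin ea → Fin m)
      (eb : Fin m → ℕ) (b : (j : Fin m) → MockProto l (eb j))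
      (bRet : (j : Fin m) → Fin (eb j) → Fin e) : MockProto (l + 1) e

namespace MockProto

/-- The exit vertex at which the matched path for the assignment `x` leaves the head grouping. At
level `l + 1` the path calls `a`, which interprets the first half of `x`, returns along the matching
return edge to a middle vertex `j`, calls `b j`, which interprets the second half of `x`, and returns
along the matching return edge to an exit vertex. -/
def run : {l e : ℕ} → MockProto l e → (Fin (2 ^ l) → Bool) → Fin e
  | _, _, dontCare, _ => 0
  | _, _, fork, x => if x 0 then 1 else 0
  | _, _, grouping a aRet _ b bRet, x =>
      let j := aRet (a.run (firstHalf x))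
      bRet j ((b j).run (secondHalf x))

/-- The number of exit vertices, counted from the left, that are used up by the B-connections that
precede the `j`-th one: the least `n` such that all their return edges lead to exit vertices with an
index `< n`. -/
def usedExits {m e : ℕ} {eb : Fin m → ℕ} (bRet : (j : Fin m) → Fin (eb j) → Fin e)
    (j : Fin m) : ℕ :=
  (Finset.univ.filter (· < j)).sup fun j' => Finset.univ.sup fun i => (bRet j' i : ℕ) + 1

/-- The sub-sequence of the return tuple of the `j`-th B-connection that consists of the exit
vertices not used by the preceding B-connections. -/
def freshExits {m e : ℕ} {eb : Fin m → ℕ} (bRet : (j : Fin m) → Fin (eb j) → Fin e)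
    (j : Fin m) : List ℕ :=
  (List.ofFn fun i => (bRet j i : ℕ)).filter fun t => decide (usedExits bRet j ≤ t)

/-- The structural invariants, for every grouping of the structure. That a proto-CFLOBDD never
contains two separate instances of equal proto-CFLOBDDs is built in: equal sub-terms are one and the
same grouping (see `groupings`). -/
def IsProto : {l e : ℕ} → MockProto l e → Prop
  | _, _, dontCare => True
  | _, _, fork => True
  | _, _, grouping (ea := ea) (m := m) (e := e) a aRet eb b bRet =>
      a.IsProto ∧ (∀ j, (b j).IsProto) ∧
      -- the A-return tuple is the identity map onto the middle vertices
      (ea = m ∧ ∀ i, (aRet i : ℕ) = i) ∧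
      -- the B-return tuples have no repetitions
      (∀ j, Function.Injective (bRet j)) ∧
      -- each B-return tuple compactly extends the preceding ones
      (∀ j, freshExits bRet j = List.range' (usedExits bRet j) (freshExits bRet j).length) ∧
      -- every exit vertex is the target of a return edge
      (∀ t : Fin e, ∃ j i, bRet j i = t) ∧
      -- different B-connections differ in the callee or in the return tuple
      (∀ j j' : Fin m,
        (⟨eb j, b j, bRet j⟩ : Σ n : ℕ, MockProto _ n × (Fin n → Fin e)) =
          ⟨eb j', b j', bRet j'⟩ → j = j')

open Classical in
/-- The groupings: the distinct sub-terms, each with its level and its number of exit vertices. -/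
noncomputable def groupings :
    {l e : ℕ} → MockProto l e → Finset (Σ l : ℕ, Σ e : ℕ, MockProto l e)
  | _, _, dontCare => {⟨0, 1, dontCare⟩}
  | _, _, fork => {⟨0, 2, fork⟩}
  | _, _, grouping a aRet eb b bRet =>
      insert ⟨_, _, grouping a aRet eb b bRet⟩
        (a.groupings ∪ Finset.univ.biUnion fun j => (b j).groupings)

/-- The number of vertices of the head grouping: entry vertex, middle vertices, exit vertices.
Vertices of level-`0` groupings are not counted. -/
def headVertices : {l e : ℕ} → MockProto l e → ℕ
  | _, _, dontCare => 0
  | _, _, fork => 0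
  | _, _, grouping (m := m) (e := e) _ _ _ _ _ => 1 + m + e

/-- The number of edges of the head grouping: its A-call edge and A-return edges, its B-call edges
and B-return edges. Edges of level-`0` groupings are not counted. -/
def headEdges : {l e : ℕ} → MockProto l e → ℕ
  | _, _, dontCare => 0
  | _, _, fork => 0
  | _, _, grouping (ea := ea) (m := m) _ _ eb _ _ => (1 + ea) + (m + ∑ j, eb j)

end MockProto

/-- A level-`k` CFLOBDD over the variables `x_0, …, x_{2^k-1}`, in this order, with terminal values
in `V`: a level-`k` proto-CFLOBDD, with value edges from its exit vertices to distinct values. -/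
structure CFLOBDD (V : Type) (k : ℕ) where
  exits : ℕ
  head : MockProto k exits
  isProto : head.IsProto
  value : Fin exits → V
  value_injective : Function.Injective value

namespace CFLOBDD

variable {V : Type} {k : ℕ}

/-- The interpretation of an assignment: follow the matched path, then the value edge. -/
def eval (C : CFLOBDD V k) (x : Fin (2 ^ k) → Bool) : V := C.value (C.head.run x)

/-- `C` is a CFLOBDD for the function `f`. -/
def Represents (C : CFLOBDD V k) (f : (Fin (2 ^ k) → Bool) → V) : Prop :=
  ∀ x, C.eval x = f x

/-- `|G(C)|`, the number of groupings. -/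
noncomputable def numGroupings (C : CFLOBDD V k) : ℕ := C.head.groupings.card

/-- `|V(C)|`, the number of vertices (level `0` and terminal values excluded). -/
noncomputable def numVertices (C : CFLOBDD V k) : ℕ :=
  ∑ g ∈ C.head.groupings, g.2.2.headVertices

/-- `|E(C)|`, the number of edges (level `0` and value edges excluded). -/
noncomputable def numEdges (C : CFLOBDD V k) : ℕ :=
  ∑ g ∈ C.head.groupings, g.2.2.headEdges

end CFLOBDD

/-! ### The family `f_k` -/

/-- The `k`-bit equality check at depth `c`: the vectors `Y = (x_{c-k}, …, x_{c-1})` and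
`Z = (x_c, …, x_{c+k-1})` are equal. -/
def EqCheck (k c : ℕ) (x : Fin (2 ^ k) → Bool) : Prop :=
  ∀ i j : Fin (2 ^ k), c ≤ (j : ℕ) → (j : ℕ) < c + k → (i : ℕ) + k = j → x i = x j

open Classical in
/-- `f_k`: the conjunction of the `k`-bit equality checks at `1/2`, `5/8` and `3/4` of `2 ^ k`.
It is meant for `7 ≤ k`: then the three divisions are exact, and the six vectors that are compared
lie inside the range of the variables and do not overlap. -/
noncomputable def tightFun (k : ℕ) (x : Fin (2 ^ k) → Bool) : Bool :=
  decide (EqCheck k (2 ^ k / 2) x ∧ EqCheck k (5 * 2 ^ k / 8) x ∧ EqCheck k (3 * 2 ^ k / 4) x)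

end DD

/-! The size of the BDD comes from counting pending comparisons. The three checks are so far apart
that at each depth at most one is pending. At distance t from the middle of a check, k - t bits are
remembered, giving at most 2^(k-t) states and one dead state. These geometric sums and the constant
contribution of the other plies give O(2^k); a node on every ply gives the lower bound.

For the CFLOBDD, the structural invariants force canonicity (`MockProto.canonical`): a proto-CFLOBDD
is determined by the partition that it induces on assignments. Hence the middle vertices of a
grouping correspond to the residuals after its first half, and the exits of a callee to the
residuals after the block that it reads. `MockProto.Realizes` expresses this and passes to A- and
B-callees.

The check at 1/2 straddles the two top-level calls, so each word w = Y_0 has its own B-callee, which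
must test whether its input begins with w. This dependence survives along the chain of A-callees as
long as a block contains k bits (`eq_of_realizes_tightAfter`). So each of at least k/2 levels has
2^k distinct groupings. At level k-1 each of them needs 2^k middle vertices, since the check at 3/4
straddles its two halves. At level k-2 the check at 5/8 forces 2^k middle vertices, and each
B-callee needs 2^k exits in order to remember Y_2; that makes 2^(2k) return edges per grouping. -/

namespace DD

/-! ### Return tuples as restricted growth families -/

/-- A family of indices is of restricted growth if every value below an attained one is attained
earlier, with respect to the lexicographic order on the positions. -/
def RestrictedGrowth {m : ℕ} {eb : Fin m → ℕ} (r : (j : Fin m) → Fin (eb j) → ℕ) : Prop :=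
  ∀ j i t, t < r j i → ∃ j', ∃ i' : Fin (eb j'), (j' < j ∨ j' = j ∧ (i' : ℕ) < i) ∧ r j' i' = t

/-- A restricted growth family is determined by its kernel. -/
theorem RestrictedGrowth.unique {m : ℕ} {eb : Fin m → ℕ} {r r' : (j : Fin m) → Fin (eb j) → ℕ}
    (hr : RestrictedGrowth r) (hr' : RestrictedGrowth r')
    (h : ∀ j i j' i', r j i = r j' i' ↔ r' j i = r' j' i') : ∀ j i, r j i = r' j i := by
  intro j
  induction j using WellFoundedLT.induction with
  | ind j ihj =>
  intro i
  induction i using WellFoundedLT.induction with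
  | ind i ihi =>
  have key : ∀ j', ∀ i' : Fin (eb j'), (j' < j ∨ j' = j ∧ (i' : ℕ) < i) → r j' i' = r' j' i' := by
    rintro j' i' (hlt | ⟨rfl, hlt⟩)
    · exact ihj j' hlt i'
    · exact ihi i' hlt
  -- At a first disagreement the smaller value occurs earlier in the other family, where both agree;
  -- so one family has a coincidence that the other lacks.
  rcases lt_trichotomy (r j i) (r' j i) with hlt | heq | hlt
  · obtain ⟨j', i', hlex, he⟩ := hr' j i _ hlt
    have h1 := key j' i' hlex
    have := (h j' i' j i).mp (h1.trans he)
    omega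
  · exact heq
  · obtain ⟨j', i', hlex, he⟩ := hr j i _ hlt
    have h1 := key j' i' hlex
    have := (h j' i' j i).mpr (h1.symm.trans he)
    omega

theorem exists_le_of_lt_usedExits {m e : ℕ} {eb : Fin m → ℕ}
    {bRet : (j : Fin m) → Fin (eb j) → Fin e} {j : Fin m} {t : ℕ}
    (h : t < MockProto.usedExits bRet j) : ∃ j' < j, ∃ i, t ≤ bRet j' i := by
  unfold MockProto.usedExits at h
  rw [Finset.lt_sup_iff] at h
  obtain ⟨j', hj', h⟩ := h
  rw [Finset.lt_sup_iff] at h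
  obtain ⟨i, -, h⟩ := h
  exact ⟨j', (Finset.mem_filter.mp hj').2, i, by omega⟩

theorem lt_usedExits {m e : ℕ} {eb : Fin m → ℕ}
    {bRet : (j : Fin m) → Fin (eb j) → Fin e} {j j' : Fin m} (h : j' < j) (i : Fin (eb j')) :
    (bRet j' i : ℕ) < MockProto.usedExits bRet j := by
  unfold MockProto.usedExits
  rw [Finset.lt_sup_iff]
  refine ⟨j', by simpa using h, ?_⟩
  rw [Finset.lt_sup_iff]
  exact ⟨i, Finset.mem_univ _, by omega⟩

/-- A value below `usedExits` is handled by induction on the connection. Any other is in the same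
consecutive run as the given value, and the run is increasing, so it comes earlier in the tuple. -/
theorem restrictedGrowth_of_freshExits {m e : ℕ} {eb : Fin m → ℕ}
    {bRet : (j : Fin m) → Fin (eb j) → Fin e}
    (h : ∀ j, MockProto.freshExits bRet j =
      List.range' (MockProto.usedExits bRet j) (MockProto.freshExits bRet j).length) :
    RestrictedGrowth fun j i => (bRet j i : ℕ) := by
  intro j
  induction j using WellFoundedLT.induction with
  | ind j ih =>
  intro i t ht
  by_cases hu : t < MockProto.usedExits bRet j
  · obtain ⟨j', hj', i', hi'⟩ := exists_le_of_lt_usedExits hu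
    rcases hi'.eq_or_lt with heq | hlt
    · exact ⟨j', i', Or.inl hj', heq.symm⟩
    · obtain ⟨j'', i'', hlex, he⟩ := ih j' hj' i' t hlt
      refine ⟨j'', i'', Or.inl ?_, he⟩
      rcases hlex with h1 | ⟨rfl, -⟩
      · exact h1.trans hj'
      · exact hj'
  · have hmem : ∀ s, s ∈ MockProto.freshExits bRet j ↔
        (∃ i, (bRet j i : ℕ) = s) ∧ MockProto.usedExits bRet j ≤ s := by
      intro s
      simp [MockProto.freshExits, List.mem_ofFn]
    have hs := (hmem (bRet j i)).mpr ⟨⟨i, rfl⟩, by simp only at ht; omega⟩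
    have htm : t ∈ MockProto.freshExits bRet j := by
      rw [h j, List.mem_range'_1] at hs ⊢
      simp only at ht
      omega
    obtain ⟨⟨i', hi'⟩, -⟩ := (hmem t).mp htm
    refine ⟨j, i', Or.inr ⟨rfl, ?_⟩, hi'⟩
    by_contra hle
    have hne : i ≠ i' := by
      rintro rfl
      simp only at ht
      omega
    have hlt : i < i' := lt_of_le_of_ne (by simpa using hle) hne
    have hp : (MockProto.freshExits bRet j).Pairwise (· < ·) := by
      rw [h j]
      exact List.pairwise_lt_range'
    unfold MockProto.freshExits at hp
    rw [List.pairwise_filter, List.pairwise_ofFn] at hp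
    have := hp hlt (by simp only at ht; simp; omega) (by simp; omega)
    simp only at ht
    omega

theorem eq_range'_of_pairwise_lt : ∀ (L : List ℕ) (u : ℕ), L.Pairwise (· < ·) →
    (∀ t ∈ L, u ≤ t) → (∀ t ∈ L, ∀ s, u ≤ s → s < t → s ∈ L) → L = List.range' u L.length
  | [], _, _, _, _ => rfl
  | a :: L, u, hp, hu, hd => by
    rw [List.pairwise_cons] at hp
    have ha : a = u := by
      by_contra hne
      have h1 := hu a (by simp)
      have h2 := hd a (by simp) u le_rfl (by omega)
      rcases List.mem_cons.mp h2 with h3 | h3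
      · exact hne h3.symm
      · have := hp.1 u h3
        omega
    subst ha
    rw [List.length_cons, List.range'_succ,
      ← eq_range'_of_pairwise_lt L (a + 1) hp.2 (fun t ht => hp.1 t ht) ?_]
    intro t ht s hs hst
    rcases List.mem_cons.mp (hd t (by simp [ht]) s (by omega) hst) with h3 | h3
    · omega
    · exact h3

theorem freshExits_of_restrictedGrowth {m e : ℕ} {eb : Fin m → ℕ}
    {bRet : (j : Fin m) → Fin (eb j) → Fin e} (hinj : ∀ j, Function.Injective (bRet j))
    (h : RestrictedGrowth fun j i => (bRet j i : ℕ)) (j : Fin m) :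
    MockProto.freshExits bRet j =
      List.range' (MockProto.usedExits bRet j) (MockProto.freshExits bRet j).length := by
  have hmem : ∀ s, s ∈ MockProto.freshExits bRet j ↔
      (∃ i, (bRet j i : ℕ) = s) ∧ MockProto.usedExits bRet j ≤ s := by
    intro s
    simp [MockProto.freshExits, List.mem_ofFn]
  have key : ∀ i t, t < (bRet j i : ℕ) → MockProto.usedExits bRet j ≤ t →
      ∃ i' < i, (bRet j i' : ℕ) = t := by
    intro i t ht hu
    obtain ⟨j', i', h1 | ⟨rfl, h1⟩, he⟩ := h j i t ht
    · have := lt_usedExits (bRet := bRet) h1 i'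
      simp only at he
      omega
    · exact ⟨i', h1, he⟩
  apply eq_range'_of_pairwise_lt
  · unfold MockProto.freshExits
    rw [List.pairwise_filter, List.pairwise_ofFn]
    intro i i' hlt _ h2
    by_contra hle
    rcases (not_lt.mp hle).eq_or_lt with heq | hlt'
    · exact hlt.ne' (hinj j (Fin.ext heq))
    · obtain ⟨i'', h1, h3⟩ := key i _ hlt' (by simpa using h2)
      exact (h1.trans hlt).ne (hinj j (Fin.ext h3))
  · exact fun t ht => ((hmem t).mp ht).2
  · intro t ht s hs hst
    obtain ⟨⟨i, rfl⟩, -⟩ := (hmem t).mp ht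
    obtain ⟨i', -, he⟩ := key i s hst hs
    exact (hmem s).mpr ⟨⟨i', he⟩, hs⟩

/-- Every finite family over a linear order has the same kernel as a surjective family of indices
in which the values appear in order. -/
theorem exists_restrictedGrowth_of_linearOrder {ι W : Type*} [LinearOrder ι] [Fintype ι]
    (v : ι → W) : ∃ (n : ℕ) (r : ι → Fin n), Function.Surjective r ∧
      (∀ p q, r p = r q ↔ v p = v q) ∧ ∀ p, ∀ t < r p, ∃ q < p, r q = t := by
  classical
  let occ : ι → Finset ι := fun p => Finset.univ.filter fun q => v q = v p
  have hocc : ∀ p, (occ p).Nonempty := fun p => ⟨p, by simp [occ]⟩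
  let first : ι → ι := fun p => (occ p).min' (hocc p)
  have hv : ∀ p, v (first p) = v p := fun p => by
    have := (occ p).min'_mem (hocc p)
    simpa [occ] using this
  have hle : ∀ p, first p ≤ p := fun p => (occ p).min'_le p (by simp [occ])
  have hfirst : ∀ p q, first p = first q ↔ v p = v q := by
    intro p q
    constructor
    · intro h
      rw [← hv p, h, hv]
    · intro h
      have : occ p = occ q := by simp [occ, h]
      simp only [first, this]
  -- Values are numbered by the order of their first occurrences.
  let S : Finset ι := Finset.univ.image first
  have hS : ∀ p, first p ∈ S := fun p => Finset.mem_image_of_mem _ (Finset.mem_univ p)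
  let o := S.orderIsoOfFin rfl
  have hrep : ∀ t, first (o t) = o t := by
    intro t
    obtain ⟨p, -, hp⟩ := Finset.mem_image.mp (o t).2
    rw [← hp, hfirst, hv]
  refine ⟨S.card, fun p => o.symm ⟨first p, hS p⟩, ?_, ?_, ?_⟩
  · intro t
    refine ⟨o t, ?_⟩
    simp only [hrep]
    exact o.symm_apply_apply t
  · intro p q
    rw [o.symm.injective.eq_iff, Subtype.mk.injEq, hfirst]
  · intro p t ht
    refine ⟨o t, ?_, ?_⟩
    · have : o t < ⟨first p, hS p⟩ := by
        rw [← o.apply_symm_apply ⟨first p, hS p⟩]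
        exact o.lt_iff_lt.mpr ht
      exact lt_of_lt_of_le this (hle p)
    · simp only [hrep]
      exact o.symm_apply_apply t

theorem exists_restrictedGrowth {m : ℕ} {eb : Fin m → ℕ} {W : Type*}
    (v : (j : Fin m) → Fin (eb j) → W) :
    ∃ (e : ℕ) (r : (j : Fin m) → Fin (eb j) → Fin e), (∀ t, ∃ j i, r j i = t) ∧
      (∀ j i j' i', r j i = r j' i' ↔ v j i = v j' i') ∧
      RestrictedGrowth fun j i => (r j i : ℕ) := by
  obtain ⟨e, r, hs, hk, hg⟩ := exists_restrictedGrowth_of_linearOrder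
    (ι := Σₗ j : Fin m, Fin (eb j)) fun p => v (ofLex p).1 (ofLex p).2
  refine ⟨e, fun j i => r (toLex ⟨j, i⟩), ?_, ?_, ?_⟩
  · intro t
    obtain ⟨p, hp⟩ := hs t
    exact ⟨(ofLex p).1, (ofLex p).2, hp⟩
  · intro j i j' i'
    exact hk _ _
  · intro j i t ht
    obtain ⟨q, hq, he⟩ := hg (toLex ⟨j, i⟩) ⟨t, ht.trans (r (toLex ⟨j, i⟩)).2⟩ ht
    obtain ⟨⟨j', i'⟩, rfl⟩ := toLex.surjective q
    refine ⟨j', i', ?_, congrArg Fin.val he⟩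
    rcases (Sigma.Lex.lt_def).mp hq with h | ⟨h, h'⟩
    · exact Or.inl h
    · obtain rfl : j' = j := h
      exact Or.inr ⟨rfl, h'⟩

end DD
-- Canonicity and existence of proto-CFLOBDDs
namespace DD

/-- The assignment that agrees with `x` on the first `d` variables and continues with `z`. -/
def glue (d : ℕ) (x z : ℕ → Bool) : ℕ → Bool := fun n => if n < d then x n else z (n - d)

theorem glue_of_lt {d n : ℕ} (x z : ℕ → Bool) (h : n < d) : glue d x z n = x n := if_pos h

theorem glue_of_le {d n : ℕ} (x z : ℕ → Bool) (h : d ≤ n) : glue d x z n = z (n - d) :=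
  if_neg (by omega)

theorem glue_shift (d : ℕ) (x : ℕ → Bool) : glue d x (fun n => x (d + n)) = x := by
  funext n
  unfold glue
  split_ifs with h
  · rfl
  · change x (d + (n - d)) = x n
    congr 1
    omega

theorem glue_add (d d' : ℕ) (x y z : ℕ → Bool) :
    glue (d + d') (glue d x y) z = glue d x (glue d' y z) := by
  funext n
  unfold glue
  split_ifs with h1 h2 h3 h4 h5 <;> first | rfl | omega | (congr 1; omega)

namespace MockProto

/-- `run` on an infinite assignment, of which only the first `2 ^ l` values are read. -/
def runNat {l e : ℕ} (P : MockProto l e) (x : ℕ → Bool) : Fin e := P.run fun i => x i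

theorem runNat_dontCare (x : ℕ → Bool) : dontCare.runNat x = 0 := rfl

theorem runNat_fork (x : ℕ → Bool) : fork.runNat x = if x 0 then 1 else 0 := rfl

theorem runNat_grouping {l ea m e : ℕ} (a : MockProto l ea) (aRet : Fin ea → Fin m)
    (eb : Fin m → ℕ) (b : (j : Fin m) → MockProto l (eb j))
    (bRet : (j : Fin m) → Fin (eb j) → Fin e) (x : ℕ → Bool) :
    (grouping a aRet eb b bRet).runNat x =
      bRet (aRet (a.runNat x)) ((b (aRet (a.runNat x))).runNat fun n => x (2 ^ l + n)) := rfl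

theorem runNat_congr {l e : ℕ} (P : MockProto l e) {x y : ℕ → Bool}
    (h : ∀ n < 2 ^ l, x n = y n) : P.runNat x = P.runNat y := by
  unfold runNat
  congr 1
  funext i
  exact h i i.2

theorem runNat_glue {l e : ℕ} (P : MockProto l e) (x z : ℕ → Bool) :
    P.runNat (glue (2 ^ l) x z) = P.runNat x :=
  P.runNat_congr fun _ h => glue_of_lt x z h

theorem runNat_grouping_glue {l m e : ℕ} (a : MockProto l m) (eb : Fin m → ℕ)
    (b : (j : Fin m) → MockProto l (eb j)) (bRet : (j : Fin m) → Fin (eb j) → Fin e)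
    (x z : ℕ → Bool) : (grouping a id eb b bRet).runNat (glue (2 ^ l) x z) =
      bRet (a.runNat x) ((b (a.runNat x)).runNat z) := by
  rw [runNat_grouping, runNat_glue]
  simp [glue]

/-- The structural invariants of a grouping, with the identity as A-return tuple. -/
theorem isProto_grouping_iff {l m e : ℕ} {a : MockProto l m} {eb : Fin m → ℕ}
    {b : (j : Fin m) → MockProto l (eb j)} {bRet : (j : Fin m) → Fin (eb j) → Fin e} :
    (grouping a id eb b bRet).IsProto ↔ a.IsProto ∧ (∀ j, (b j).IsProto) ∧
      (∀ j, Function.Injective (bRet j)) ∧ (RestrictedGrowth fun j i => (bRet j i : ℕ)) ∧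
      (∀ t : Fin e, ∃ j i, bRet j i = t) ∧
      (∀ j j' : Fin m,
        (⟨eb j, b j, bRet j⟩ : Σ n : ℕ, MockProto _ n × (Fin n → Fin e)) =
          ⟨eb j', b j', bRet j'⟩ → j = j') := by
  simp only [IsProto]
  constructor
  · rintro ⟨h1, h2, -, h4, h5, h6, h7⟩
    exact ⟨h1, h2, h4, restrictedGrowth_of_freshExits h5, h6, h7⟩
  · rintro ⟨h1, h2, h4, h5, h6, h7⟩
    exact ⟨h1, h2, ⟨trivial, fun _ => rfl⟩, h4, freshExits_of_restrictedGrowth h4 h5, h6, h7⟩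

theorem IsProto.exists_eq_grouping {l e : ℕ} {P : MockProto (l + 1) e} (h : P.IsProto) :
    ∃ (m : ℕ) (a : MockProto l m) (eb : Fin m → ℕ) (b : (j : Fin m) → MockProto l (eb j))
      (bRet : (j : Fin m) → Fin (eb j) → Fin e), P = grouping a id eb b bRet := by
  cases P with
  | @grouping _ ea m _ a aRet eb b bRet =>
    have h' := h
    simp only [IsProto] at h'
    obtain ⟨-, -, ⟨rfl, hid⟩, -⟩ := h'
    obtain rfl : aRet = id := funext fun i => Fin.ext (hid i)
    exact ⟨_, a, eb, b, bRet, rfl⟩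

/-- This lets every vertex index be replaced by an assignment that reaches it, so that statements
about vertices become statements about the induced partition. -/
theorem IsProto.runNat_surjective : ∀ {l e : ℕ} {P : MockProto l e}, P.IsProto →
    Function.Surjective P.runNat
  | 0, _, dontCare, _ => fun t => ⟨fun _ => false, Subsingleton.elim _ _⟩
  | 0, _, fork, _ => fun t => by
    refine ⟨fun _ => decide (t = 1), ?_⟩
    rw [runNat_fork]
    fin_cases t <;> rfl
  | l + 1, e, P, h => fun t => by
    obtain ⟨m, a, eb, b, bRet, rfl⟩ := h.exists_eq_grouping
    obtain ⟨ha, hb, -, -, hs, -⟩ := isProto_grouping_iff.mp h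
    obtain ⟨j, i, rfl⟩ := hs t
    obtain ⟨x, rfl⟩ := ha.runNat_surjective j
    obtain ⟨y, rfl⟩ := (hb (a.runNat x)).runNat_surjective i
    refine ⟨glue (2 ^ l) x y, ?_⟩
    rw [runNat_grouping_glue]

/-- Two proto-CFLOBDDs are equal if they induce the same partition of the assignments. -/
def Canonical (l : ℕ) : Prop := ∀ ⦃e e' : ℕ⦄ ⦃P : MockProto l e⦄ ⦃P' : MockProto l e'⦄,
  P.IsProto → P'.IsProto → (∀ x y, P.runNat x = P.runNat y ↔ P'.runNat x = P'.runNat y) →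
    (⟨e, P⟩ : Σ e, MockProto l e) = ⟨e', P'⟩

theorem Canonical.eq_of_comp_eq {l : ℕ} (hl : Canonical l) {e e' n : ℕ} {P : MockProto l e}
    {P' : MockProto l e'} (hP : P.IsProto) (hP' : P'.IsProto) {r : Fin e → Fin n}
    {r' : Fin e' → Fin n} (hr : Function.Injective r) (hr' : Function.Injective r')
    (h : ∀ x, r (P.runNat x) = r' (P'.runNat x)) :
    (⟨e, P, r⟩ : Σ e : ℕ, MockProto l e × (Fin e → Fin n)) = ⟨e', P', r'⟩ := by
  have hE := hl hP hP' fun x y => by rw [← hr.eq_iff, h, h, hr'.eq_iff]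
  obtain ⟨rfl, hE⟩ := Sigma.mk.inj_iff.mp hE
  obtain rfl := eq_of_heq hE
  obtain rfl : r = r' := by
    funext i
    obtain ⟨x, rfl⟩ := hP.runNat_surjective i
    exact h x
  rfl

/-- The middle vertices of a proto-CFLOBDD correspond to the residuals of the first half. -/
theorem Canonical.runNat_eq_iff {l : ℕ} (hl : Canonical l) {m e : ℕ} {a : MockProto l m}
    {eb : Fin m → ℕ} {b : (j : Fin m) → MockProto l (eb j)}
    {bRet : (j : Fin m) → Fin (eb j) → Fin e} (h : (grouping a id eb b bRet).IsProto)
    (x y : ℕ → Bool) : a.runNat x = a.runNat y ↔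
      ∀ z, (grouping a id eb b bRet).runNat (glue (2 ^ l) x z) =
        (grouping a id eb b bRet).runNat (glue (2 ^ l) y z) := by
  obtain ⟨-, hb, hi, -, -, hd⟩ := isProto_grouping_iff.mp h
  simp only [runNat_grouping_glue]
  constructor
  · intro h z
    rw [h]
  · intro h
    -- Equal residuals would make two B-connections agree in callee and return tuple, which the last
    -- invariant forbids.
    exact hd _ _ (hl.eq_of_comp_eq (hb _) (hb _) (hi _) (hi _) h)

/-- Induction on the level. The partition determines the residuals of the first half, hence the
A-callee. Since return tuples are injective, it also determines each B-callee. What remains is the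
kernel of the return tuples, and restricted growth makes the kernel determine them. -/
theorem canonical : ∀ l, Canonical l
  | 0 => by
    intro e e' P P' _ _ h
    cases P <;> cases P'
    · rfl
    · have := h (fun _ => true) (fun _ => false)
      simp [runNat_dontCare, runNat_fork] at this
    · have := h (fun _ => true) (fun _ => false)
      simp [runNat_dontCare, runNat_fork] at this
    · rfl
  | l + 1 => by
    intro e e' P P' hP hP' hk
    have hl := canonical l
    obtain ⟨m, a, eb, b, bRet, rfl⟩ := hP.exists_eq_grouping
    obtain ⟨m', a', eb', b', bRet', rfl⟩ := hP'.exists_eq_grouping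
    obtain ⟨ha, hb, hi, hg, hs, -⟩ := isProto_grouping_iff.mp hP
    obtain ⟨ha', hb', hi', hg', hs', -⟩ := isProto_grouping_iff.mp hP'
    have hA := hl ha ha' fun x y => by
      rw [hl.runNat_eq_iff hP, hl.runNat_eq_iff hP']
      exact forall_congr' fun z => hk _ _
    obtain ⟨rfl, hA⟩ := Sigma.mk.inj_iff.mp hA
    obtain rfl := eq_of_heq hA
    have hB : ∀ j, (⟨eb j, b j⟩ : Σ e, MockProto l e) = ⟨eb' j, b' j⟩ := by
      intro j
      obtain ⟨x, rfl⟩ := ha.runNat_surjective j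
      refine hl (hb _) (hb' _) fun y z => ?_
      have := hk (glue (2 ^ l) x y) (glue (2 ^ l) x z)
      rwa [runNat_grouping_glue, runNat_grouping_glue, runNat_grouping_glue,
        runNat_grouping_glue, (hi _).eq_iff, (hi' _).eq_iff] at this
    obtain rfl : eb = eb' := funext fun j => congrArg Sigma.fst (hB j)
    obtain rfl : b = b' := funext fun j => eq_of_heq (Sigma.mk.inj_iff.mp (hB j)).2
    have hR := hg.unique hg' fun j i j' i' => by
      obtain ⟨x, rfl⟩ := ha.runNat_surjective j
      obtain ⟨x', rfl⟩ := ha.runNat_surjective j'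
      obtain ⟨y, rfl⟩ := (hb _).runNat_surjective i
      obtain ⟨y', rfl⟩ := (hb _).runNat_surjective i'
      have := hk (glue (2 ^ l) x y) (glue (2 ^ l) x' y')
      rwa [runNat_grouping_glue, runNat_grouping_glue, runNat_grouping_glue,
        runNat_grouping_glue, Fin.ext_iff, Fin.ext_iff] at this
    obtain rfl : e = e' := by
      apply le_antisymm
      · refine le_of_forall_lt fun t ht => ?_
        obtain ⟨j, i, hji⟩ := hs ⟨t, ht⟩
        have h1 := hR j i
        simp only [hji] at h1
        exact h1 ▸ (bRet' j i).2
      · refine le_of_forall_lt fun t ht => ?_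
        obtain ⟨j, i, hji⟩ := hs' ⟨t, ht⟩
        have h1 := hR j i
        simp only [hji] at h1
        exact h1 ▸ (bRet j i).2
    obtain rfl : bRet = bRet' := funext fun j => funext fun i => Fin.ext (hR j i)
    rfl

/-- Every function of the assignments is computed by a proto-CFLOBDD, up to an injective labelling
of the exit vertices. -/
theorem exists_isProto : ∀ (l : ℕ) {W : Type} (g : (Fin (2 ^ l) → Bool) → W),
    ∃ (e : ℕ) (P : MockProto l e) (v : Fin e → W), P.IsProto ∧ Function.Injective v ∧
      ∀ x, v (P.run x) = g x
  | 0, W, g => by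
    have hx : ∀ x : Fin (2 ^ 0) → Bool, x = fun _ => x 0 := fun x =>
      funext fun i => congrArg x (Subsingleton.elim (α := Fin 1) _ _)
    by_cases h : g (fun _ => false) = g (fun _ => true)
    · refine ⟨1, dontCare, fun _ => g fun _ => false, trivial,
        Function.injective_of_subsingleton _, fun x => ?_⟩
      rw [hx x]
      cases x 0
      · rfl
      · exact h
    · refine ⟨2, fork, fun t => g fun _ => decide (t = 1), trivial, ?_, fun x => ?_⟩
      · intro s t hst
        fin_cases s <;> fin_cases t <;> simp_all
      · rw [hx x]
        cases x 0 <;> simp [run]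
  | l + 1, W, g => by
    let join : (Fin (2 ^ l) → Bool) → (Fin (2 ^ l) → Bool) → Fin (2 ^ (l + 1)) → Bool :=
      fun x y i => if h : (i : ℕ) < 2 ^ l then x ⟨i, h⟩ else y ⟨i - 2 ^ l, by
        have h1 := i.2
        have h2 := pow_succ 2 l
        omega⟩
    have hjoin : ∀ x, join (firstHalf x) (secondHalf x) = x := by
      intro x
      funext i
      simp only [join, firstHalf, secondHalf]
      split_ifs with h
      · rfl
      · congr 1
        ext
        simp only
        omega
    -- The labels are functions of the second half: `va j` is the residual that belongs to middle
    -- vertex `j`.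
    obtain ⟨m, a, va, ha, hva, hav⟩ := exists_isProto l fun x y => g (join x y)
    choose eb b vb hb hvb hbv using fun j => exists_isProto l (va j)
    obtain ⟨e, r, hs, hk, hg⟩ := exists_restrictedGrowth vb
    have hex : ∀ t : Fin e, ∃ w, ∀ j i, r j i = t → vb j i = w := by
      intro t
      obtain ⟨j, i, rfl⟩ := hs t
      exact ⟨vb j i, fun j' i' h => (hk _ _ _ _).mp h⟩
    choose v hv using hex
    refine ⟨e, grouping a id eb b r, v, isProto_grouping_iff.mpr ⟨ha, hb, ?_, hg, hs, ?_⟩, ?_, ?_⟩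
    · intro j i i' h
      exact hvb j ((hk _ _ _ _).mp h)
    · intro j j' h
      apply hva
      funext x
      rw [← hbv, ← hbv, hv _ _ _ rfl, hv _ _ _ rfl]
      congr 1
      exact congrArg (fun s : Σ n : ℕ, MockProto l n × (Fin n → Fin e) => s.2.2 (s.2.1.run x)) h
    · intro t t' h
      obtain ⟨j, i, rfl⟩ := hs t
      obtain ⟨j', i', rfl⟩ := hs t'
      rw [← hv _ _ _ rfl, ← hv _ _ _ rfl] at h
      exact (hk _ _ _ _).mpr h
    · intro x
      rw [run]
      simp only [id]
      rw [← hv _ _ _ rfl, hbv, hav]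
      change g (join _ _) = _
      rw [hjoin]

end MockProto

theorem CFLOBDD.exists_represents {V : Type} {k : ℕ} (f : (Fin (2 ^ k) → Bool) → V) :
    ∃ C : CFLOBDD V k, C.Represents f := by
  obtain ⟨e, P, v, hP, hv, h⟩ := MockProto.exists_isProto k f
  exact ⟨⟨e, P, hP, v, hv⟩, h⟩

end DD
-- Size bounds for quasi-reduced BDDs
namespace DD

namespace BDD

variable {V : Type}

theorem exists_represents : ∀ {n : ℕ} (f : (Fin n → Bool) → V), ∃ B : BDD V n, B.Represents f
  | 0, f => ⟨terminal (f Fin.elim0), fun x => by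
      rw [eval]
      exact congrArg f (Subsingleton.elim _ _)⟩
  | n + 1, f => by
    obtain ⟨lo, hlo⟩ := exists_represents fun x : Fin n → Bool => f (Fin.cons false x)
    obtain ⟨hi, hhi⟩ := exists_represents fun x : Fin n → Bool => f (Fin.cons true x)
    refine ⟨node lo hi, fun x => ?_⟩
    rw [eval, hlo, hhi]
    conv_rhs => rw [← Fin.cons_self_tail x]
    cases x 0 <;> rfl

theorem mem_nodes_node {n : ℕ} {lo hi : BDD V n} {ν : Σ m, BDD V m} :
    ν ∈ (node lo hi).nodes ↔ ν = ⟨n + 1, node lo hi⟩ ∨ ν ∈ lo.nodes ∨ ν ∈ hi.nodes := by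
  simp [nodes]

/-- Every ply of a quasi-reduced BDD has a node. -/
theorem exists_mem_nodes : ∀ {n : ℕ} (B : BDD V n) (m : ℕ), m ≤ n → ∃ ν ∈ B.nodes, ν.1 = m
  | _, terminal v, m, h => ⟨_, Finset.mem_singleton_self _, (Nat.le_zero.mp h).symm⟩
  | n + 1, node lo hi, m, h => by
    rcases h.eq_or_lt with rfl | h
    · exact ⟨_, mem_nodes_node.mpr (Or.inl rfl), rfl⟩
    · obtain ⟨ν, hν, rfl⟩ := lo.exists_mem_nodes m (by omega)
      exact ⟨ν, mem_nodes_node.mpr (Or.inr (Or.inl hν)), rfl⟩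

theorem lt_size {n : ℕ} (B : BDD V n) : n < B.size := by
  have h : Finset.range (n + 1) ⊆ B.nodes.image Sigma.fst := by
    intro m hm
    obtain ⟨ν, hν, he⟩ := B.exists_mem_nodes m (by simpa [Nat.lt_succ_iff] using hm)
    exact Finset.mem_image.mpr ⟨ν, hν, he⟩
  have := (Finset.card_le_card h).trans Finset.card_image_le
  rw [Finset.card_range] at this
  exact this

/-- `eval` on an infinite assignment, of which only the first `n` values are read. -/
def evalNat {n : ℕ} (B : BDD V n) (x : ℕ → Bool) : V := B.eval fun i => x i

theorem evalNat_node {n : ℕ} (lo hi : BDD V n) (x : ℕ → Bool) :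
    (node lo hi).evalNat x = (if x 0 then hi else lo).evalNat fun n => x (1 + n) := by
  have h : (Fin.tail fun i : Fin (n + 1) => x i) = fun i : Fin n => x (1 + i) := by
    funext i
    simp [Fin.tail, Nat.add_comm]
  simp only [evalNat, eval, h]
  cases hx : x 0 <;> simp [hx]

theorem evalNat_injective : ∀ {n : ℕ} {B B' : BDD V n},
    (∀ x, B.evalNat x = B'.evalNat x) → B = B'
  | _, terminal v, terminal v', h => congrArg terminal (h fun _ => false)
  | _, node lo hi, node lo' hi', h => by
    have key : ∀ c x, (if c = true then hi else lo).evalNat x =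
        (if c = true then hi' else lo').evalNat x := by
      intro c x
      have := h (glue 1 (fun _ => c) x)
      rw [evalNat_node, evalNat_node] at this
      simpa [glue] using this
    have h1 : lo = lo' := evalNat_injective fun x => by simpa using key false x
    have h2 : hi = hi' := evalNat_injective fun x => by simpa using key true x
    rw [h1, h2]

/-- The node that is reached after `d` steps. -/
def descend : {n : ℕ} → BDD V n → ℕ → (ℕ → Bool) → Σ m, BDD V m
  | _, terminal v, _, _ => ⟨0, terminal v⟩
  | _, node lo hi, 0, _ => ⟨_, node lo hi⟩
  | _, node lo hi, d + 1, x =>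
    if x 0 then hi.descend d fun n => x (1 + n) else lo.descend d fun n => x (1 + n)

theorem descend_zero {n : ℕ} (B : BDD V n) (x : ℕ → Bool) : B.descend 0 x = ⟨n, B⟩ := by
  cases B <;> rfl

theorem descend_succ {n : ℕ} (lo hi : BDD V n) (d : ℕ) (x : ℕ → Bool) :
    (node lo hi).descend (d + 1) x = (if x 0 then hi else lo).descend d fun n => x (1 + n) := by
  rw [descend]
  cases x 0 <;> rfl

theorem exists_descend_eq : ∀ {n : ℕ} (B : BDD V n), ∀ ν ∈ B.nodes,
    ∃ d ≤ n, ∃ x, B.descend d x = ν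
  | _, terminal v, ν, h => ⟨0, le_rfl, fun _ => false, (Finset.mem_singleton.mp h).symm⟩
  | _, node lo hi, ν, h => by
    rcases mem_nodes_node.mp h with rfl | h
    · exact ⟨0, Nat.zero_le _, fun _ => false, rfl⟩
    · rcases h with h | h
      · obtain ⟨d, hd, x, hx⟩ := lo.exists_descend_eq ν h
        refine ⟨d + 1, by omega, glue 1 (fun _ => false) x, ?_⟩
        rw [descend_succ]
        simpa [glue] using hx
      · obtain ⟨d, hd, x, hx⟩ := hi.exists_descend_eq ν h
        refine ⟨d + 1, by omega, glue 1 (fun _ => true) x, ?_⟩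
        rw [descend_succ]
        simpa [glue] using hx

theorem descend_fst : ∀ (d : ℕ) {n : ℕ} (B : BDD V n) (x : ℕ → Bool), (B.descend d x).1 = n - d
  | 0, _, B, x => by rw [descend_zero]; rfl
  | d + 1, _, terminal v, x => by simp [descend]
  | d + 1, _, node lo hi, x => by
    rw [descend_succ, descend_fst d]
    omega

theorem evalNat_descend : ∀ (d : ℕ) {n : ℕ} (B : BDD V n) (x z : ℕ → Bool),
    (B.descend d x).2.evalNat z = B.evalNat (glue d x z)
  | 0, _, B, x, z => by
    rw [descend_zero]
    rfl
  | d + 1, _, terminal v, x, z => rfl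
  | d + 1, _, node lo hi, x, z => by
    rw [descend_succ, evalNat_descend d, evalNat_node]
    have h1 : glue (d + 1) x z 0 = x 0 := glue_of_lt x z (by omega)
    have h2 : (fun n => glue (d + 1) x z (1 + n)) = glue d (fun n => x (1 + n)) z := by
      funext n
      unfold glue
      split_ifs <;> first | rfl | omega | (congr 1; omega)
    rw [h1, h2]

theorem descend_eq_of_forall {n : ℕ} {B : BDD V n} {d : ℕ} {x y : ℕ → Bool}
    (h : ∀ z, B.evalNat (glue d x z) = B.evalNat (glue d y z)) :
    B.descend d x = B.descend d y := by
  have h1 : (B.descend d x).1 = (B.descend d y).1 := by rw [descend_fst, descend_fst]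
  have h2 : ∀ z, (B.descend d x).2.evalNat z = (B.descend d y).2.evalNat z := by
    intro z
    rw [evalNat_descend, evalNat_descend, h]
  generalize B.descend d x = p at h1 h2
  generalize B.descend d y = q at h1 h2
  obtain ⟨m, D⟩ := p
  obtain ⟨m', D'⟩ := q
  obtain rfl : m = m' := h1
  obtain rfl : D = D' := evalNat_injective h2
  rfl

/-- If after `d` steps the residual function is determined by a state in `S d`, then the number of
nodes is at most the total number of states. -/
theorem size_le_sum_card {n : ℕ} (B : BDD V n) {T : ℕ → Type*} (S : (d : ℕ) → Finset (T d))
    (σ : (d : ℕ) → (ℕ → Bool) → T d) (hS : ∀ d x, σ d x ∈ S d)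
    (hσ : ∀ d x y, σ d x = σ d y → ∀ z, B.evalNat (glue d x z) = B.evalNat (glue d y z)) :
    B.size ≤ ∑ d ∈ Finset.range (n + 1), (S d).card := by
  classical
  rw [← Finset.card_sigma]
  choose! dep hdep pre hpre using B.exists_descend_eq
  refine Finset.card_le_card_of_injOn (fun ν => ⟨dep ν, σ _ (pre ν)⟩) ?_ ?_
  · intro ν hν
    have := hdep ν hν
    simp only [Finset.coe_sigma, Set.mem_sigma_iff, Finset.mem_coe, Finset.mem_range]
    exact ⟨by omega, hS _ _⟩
  · intro ν hν ν' hν' h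
    obtain ⟨h1, h2⟩ := Sigma.mk.inj_iff.mp h
    rw [← hpre ν hν, ← hpre ν' hν']
    have h3 : ∀ d d', d = d' → ∀ x y, σ d x ≍ σ d' y → B.descend d x = B.descend d' y := by
      rintro d _ rfl x y he
      exact descend_eq_of_forall (hσ d x y (eq_of_heq he))
    exact h3 _ _ h1 _ _ h2

/-- A conjunction of comparisons of the variables `i ∈ P` with the variables `i + k`: the state at
depth `d` consists of the variables that still have to be compared. -/
theorem size_le_sum_of_comparisons {n : ℕ} (B : BDD V n) (k : ℕ) (P : Finset ℕ) (g : Prop → V)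
    (hB : ∀ x, B.evalNat x = g (∀ i ∈ P, x i = x (i + k))) :
    B.size ≤ ∑ d ∈ Finset.range (n + 1), (2 ^ (P.filter fun i => i < d ∧ d ≤ i + k).card + 1) := by
  classical
  let L : ℕ → Finset ℕ := fun d => P.filter fun i => i < d ∧ d ≤ i + k
  -- The state is `none` once a completed comparison has failed; otherwise it is the set of pending
  -- positions that carry the bit 1.
  refine (B.size_le_sum_card (fun d => (L d).powerset.insertNone) (fun d x =>
    if ∀ i ∈ P, i + k < d → x i = x (i + k) then some ((L d).filter fun i => x i = true)
    else none) ?_ ?_).trans ?_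
  · intro d x
    split_ifs
    · rw [Finset.some_mem_insertNone, Finset.mem_powerset]
      exact Finset.filter_subset _ _
    · exact Finset.none_mem_insertNone
  · have key : ∀ d x z, (∀ i ∈ P, glue d x z i = glue d x z (i + k)) ↔
        (∀ i ∈ P, i + k < d → x i = x (i + k)) ∧ (∀ i ∈ L d, x i = z (i + k - d)) ∧
          ∀ i ∈ P, d ≤ i → z (i - d) = z (i + k - d) := by
      intro d x z
      constructor
      · intro h
        refine ⟨fun i hi hd => ?_, fun i hi => ?_, fun i hi hd => ?_⟩
        · have := h i hi
          rwa [glue_of_lt _ _ hd, glue_of_lt _ _ (by omega)] at this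
        · obtain ⟨hi, h1, h2⟩ := Finset.mem_filter.mp hi
          have := h i hi
          rwa [glue_of_lt _ _ h1, glue_of_le _ _ h2] at this
        · have := h i hi
          rwa [glue_of_le _ _ hd, glue_of_le _ _ (by omega)] at this
      · rintro ⟨h1, h2, h3⟩ i hi
        rcases lt_or_ge (i + k) d with hd | hd
        · rw [glue_of_lt _ _ hd, glue_of_lt _ _ (by omega)]
          exact h1 i hi hd
        · rw [glue_of_le _ _ hd]
          rcases lt_or_ge i d with hd' | hd'
          · rw [glue_of_lt _ _ hd']
            exact h2 i (Finset.mem_filter.mpr ⟨hi, hd', hd⟩)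
          · rw [glue_of_le _ _ hd']
            exact h3 i hi hd'
    intro d x y h z
    rw [hB, hB]
    congr 1
    rw [key, key]
    split_ifs at h with hx hy hy
    · have hL : ∀ i ∈ L d, x i = y i := by
        intro i hi
        have := Finset.ext_iff.mp (Option.some.inj h) i
        simp only [Finset.mem_filter, hi, true_and] at this
        exact Bool.eq_iff_iff.mpr this
      simp only [eq_iff_iff]
      refine and_congr (iff_of_true hx hy) (and_congr_left fun _ => ?_)
      exact forall₂_congr fun i hi => by rw [hL i hi]
    · simp only [eq_iff_iff]
      exact iff_of_false (fun h => hx h.1) fun h => hy h.1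
  · simp [L, Finset.card_insertNone, Finset.card_powerset]

end BDD

/-- Subtraction is truncated: the terms with d ≥ k are all 1, which the summand `n` pays for. -/
theorem sum_two_pow_sub_le (n : ℕ) : ∀ k : ℕ,
    ∑ d ∈ Finset.range n, 2 ^ (k - d) ≤ 2 ^ (k + 1) + n := by
  intro k
  induction k generalizing n with
  | zero => simp
  | succ k ih =>
    cases n with
    | zero => simp
    | succ n =>
      rw [Finset.sum_range_succ']
      have := ih n
      simp only [Nat.add_sub_add_right, Nat.sub_zero]
      rw [pow_succ 2 (k + 1)]
      omega

/-- The exponent is k - |d - c|, truncated at 0. The sum splits at `c` into two one-sided sums. -/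
theorem sum_two_pow_sub_dist_le (n c k : ℕ) :
    ∑ d ∈ Finset.range n, 2 ^ (k - (c - d) - (d - c)) ≤ 2 * (2 ^ (k + 1) + n) + c := by
  calc ∑ d ∈ Finset.range n, 2 ^ (k - (c - d) - (d - c))
      ≤ ∑ d ∈ Finset.range (c + n), 2 ^ (k - (c - d) - (d - c)) :=
        Finset.sum_le_sum_of_subset (Finset.range_mono (by omega))
    _ = ∑ d ∈ Finset.range c, 2 ^ (k - (d + 1)) + ∑ d ∈ Finset.range n, 2 ^ (k - d) := by
        rw [Finset.sum_range_add, ← Finset.sum_range_reflect]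
        congr 1
        · refine Finset.sum_congr rfl fun d hd => ?_
          rw [Finset.mem_range] at hd
          congr 1
          omega
        · refine Finset.sum_congr rfl fun d hd => ?_
          congr 1
          omega
    _ ≤ ∑ d ∈ Finset.range c, 2 ^ (k - d) + ∑ d ∈ Finset.range n, 2 ^ (k - d) :=
        Nat.add_le_add_right (Finset.sum_le_sum fun d _ =>
          Nat.pow_le_pow_right (by omega) (by omega)) _
    _ ≤ (2 ^ (k + 1) + c) + (2 ^ (k + 1) + n) :=
        Nat.add_le_add (sum_two_pow_sub_le _ _) (sum_two_pow_sub_le _ _)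
    _ ≤ _ := by omega

end DD
-- The BDD for f_k, with k = K + 4 so that the depths of the checks are multiples of 2^K
namespace DD

/-- The positions of the vectors `Y_0`, `Y_1`, `Y_2` of `f_(K + 4)`. -/
def tightPositions (K : ℕ) : Finset ℕ :=
  Finset.Ico (8 * 2 ^ K - (K + 4)) (8 * 2 ^ K) ∪ Finset.Ico (10 * 2 ^ K - (K + 4)) (10 * 2 ^ K) ∪
    Finset.Ico (12 * 2 ^ K - (K + 4)) (12 * 2 ^ K)

/-- The set of infinite assignments with `f_(K + 4) = 1`. -/
def Tight (K : ℕ) (X : ℕ → Bool) : Prop := ∀ i ∈ tightPositions K, X i = X (i + (K + 4))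

/-- Checks are 2 · 2^K apart, so this gives each pair of neighbouring checks room for a Z and a Y
that do not overlap. It is the source of the bound k ≥ 7. -/
theorem add_four_le_two_pow {K : ℕ} (hK : 3 ≤ K) : K + 4 ≤ 2 ^ K := by
  induction K, hK using Nat.le_induction with
  | base => norm_num
  | succ K _ ih =>
    rw [pow_succ]
    omega

theorem two_pow_add_four (K : ℕ) : 2 ^ (K + 4) = 16 * 2 ^ K := by
  rw [pow_add]
  omega

theorem eqCheck_iff {k c : ℕ} (hk : k ≤ c) (hc : c + k ≤ 2 ^ k) (X : ℕ → Bool) :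
    EqCheck k c (fun i => X i) ↔ ∀ i ∈ Finset.Ico (c - k) c, X i = X (i + k) := by
  constructor
  · intro h i hi
    rw [Finset.mem_Ico] at hi
    exact h ⟨i, by omega⟩ ⟨i + k, by omega⟩ (by simp only; omega) (by simp only; omega) rfl
  · intro h i j h1 h2 h3
    have := h i (Finset.mem_Ico.mpr ⟨by omega, by omega⟩)
    rwa [h3] at this

open Classical in
theorem tightFun_eq {K : ℕ} (hK : 3 ≤ K) (X : ℕ → Bool) :
    tightFun (K + 4) (fun i => X i) = decide (Tight K X) := by
  have hn := add_four_le_two_pow hK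
  have hp := two_pow_add_four K
  have h0 : 2 ^ (K + 4) / 2 = 8 * 2 ^ K := by omega
  have h1 : 5 * 2 ^ (K + 4) / 8 = 10 * 2 ^ K := by omega
  have h2 : 3 * 2 ^ (K + 4) / 4 = 12 * 2 ^ K := by omega
  unfold tightFun
  rw [decide_eq_decide, h0, h1, h2, eqCheck_iff (by omega) (by omega),
    eqCheck_iff (by omega) (by omega), eqCheck_iff (by omega) (by omega)]
  simp only [Tight, tightPositions, Finset.forall_mem_union, and_assoc]

/-- Neighbouring checks are at least 2k apart, so only the first check at `c` with d ≤ c + k, or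
else the last one, can have pending positions. -/
theorem card_filter_tightPositions_le {K : ℕ} (hK : 3 ≤ K) (d : ℕ) :
    ∃ c ∈ ({8 * 2 ^ K, 10 * 2 ^ K, 12 * 2 ^ K} : Finset ℕ),
      ((tightPositions K).filter fun i => i < d ∧ d ≤ i + (K + 4)).card ≤
        K + 4 - (c - d) - (d - c) := by
  have hn := add_four_le_two_pow hK
  have key : ∀ c, (∀ i ∈ tightPositions K, i < d → d ≤ i + (K + 4) → c - (K + 4) ≤ i ∧ i < c) →
      K + 4 ≤ c → ((tightPositions K).filter fun i => i < d ∧ d ≤ i + (K + 4)).card ≤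
        K + 4 - (c - d) - (d - c) := by
    intro c h hc
    calc _ ≤ (Finset.Ico (max (c - (K + 4)) (d - (K + 4))) (min c d)).card := by
            refine Finset.card_le_card fun i hi => ?_
            obtain ⟨hi, h1, h2⟩ := Finset.mem_filter.mp hi
            have := h i hi h1 h2
            rw [Finset.mem_Ico]
            omega
      _ ≤ _ := by
            rw [Nat.card_Ico]
            omega
  rcases le_or_gt d (8 * 2 ^ K + (K + 4)) with h | h
  · refine ⟨8 * 2 ^ K, by simp, key _ (fun i hi h1 h2 => ?_) (by omega)⟩
    simp only [tightPositions, Finset.mem_union, Finset.mem_Ico] at hi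
    omega
  rcases le_or_gt d (10 * 2 ^ K + (K + 4)) with h' | h'
  · refine ⟨10 * 2 ^ K, by simp, key _ (fun i hi h1 h2 => ?_) (by omega)⟩
    simp only [tightPositions, Finset.mem_union, Finset.mem_Ico] at hi
    omega
  · refine ⟨12 * 2 ^ K, by simp, key _ (fun i hi h1 h2 => ?_) (by omega)⟩
    simp only [tightPositions, Finset.mem_union, Finset.mem_Ico] at hi
    omega

theorem BDD.size_le_of_represents_tightFun {K : ℕ} (hK : 3 ≤ K) {B : BDD Bool (2 ^ (K + 4))}
    (hB : B.Represents (tightFun (K + 4))) : B.size ≤ 22 * 2 ^ (K + 4) := by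
  classical
  have hn := add_four_le_two_pow hK
  have hp := two_pow_add_four K
  have hp' : 2 ^ (K + 4 + 1) = 32 * 2 ^ K := by
    rw [pow_succ, hp]
    omega
  have h1 := B.size_le_sum_of_comparisons (K + 4) (tightPositions K) (fun p => decide p) fun x => by
    rw [BDD.evalNat, hB, tightFun_eq hK]
    rfl
  have h2 : ∀ d, 2 ^ ((tightPositions K).filter fun i => i < d ∧ d ≤ i + (K + 4)).card + 1 ≤
      2 ^ (K + 4 - (8 * 2 ^ K - d) - (d - 8 * 2 ^ K)) +
        2 ^ (K + 4 - (10 * 2 ^ K - d) - (d - 10 * 2 ^ K)) +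
        2 ^ (K + 4 - (12 * 2 ^ K - d) - (d - 12 * 2 ^ K)) + 1 := by
    intro d
    obtain ⟨c, hc, hle⟩ := card_filter_tightPositions_le hK d
    have hpow := Nat.pow_le_pow_right (n := 2) (by omega) hle
    simp only [Finset.mem_insert, Finset.mem_singleton] at hc
    refine Nat.succ_le_succ ?_
    rcases hc with rfl | rfl | rfl
    · exact hpow.trans ((Nat.le_add_right _ _).trans (Nat.le_add_right _ _))
    · exact hpow.trans ((Nat.le_add_left _ _).trans (Nat.le_add_right _ _))
    · exact hpow.trans (Nat.le_add_left _ _)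
  have h3 := h1.trans (Finset.sum_le_sum fun d _ => h2 d)
  rw [Finset.sum_add_distrib, Finset.sum_add_distrib, Finset.sum_add_distrib, Finset.sum_const,
    Finset.card_range, smul_eq_mul] at h3
  have h4 := sum_two_pow_sub_dist_le (2 ^ (K + 4) + 1) (8 * 2 ^ K) (K + 4)
  have h5 := sum_two_pow_sub_dist_le (2 ^ (K + 4) + 1) (10 * 2 ^ K) (K + 4)
  have h6 := sum_two_pow_sub_dist_le (2 ^ (K + 4) + 1) (12 * 2 ^ K) (K + 4)
  rw [hp'] at h4 h5 h6
  omega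

/-! ### Groupings as residual classes -/

namespace MockProto

/-- `P` computes the residuals of `g` with respect to the first `2 ^ l` variables. -/
def Realizes {l e : ℕ} (P : MockProto l e) (g : (ℕ → Bool) → Prop) : Prop :=
  P.IsProto ∧ ∀ x y, P.runNat x = P.runNat y ↔
    ∀ z, g (glue (2 ^ l) x z) ↔ g (glue (2 ^ l) y z)

/-- Equality of residuals after the first half of the block is tested on continuations, and these
split into the second half and everything after the block. -/
theorem Realizes.aConnection {l m e : ℕ} {a : MockProto l m} {eb : Fin m → ℕ}
    {b : (j : Fin m) → MockProto l (eb j)} {bRet : (j : Fin m) → Fin (eb j) → Fin e}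
    {g : (ℕ → Bool) → Prop} (h : (grouping a id eb b bRet).Realizes g) : a.Realizes g := by
  refine ⟨(isProto_grouping_iff.mp h.1).1, fun x y => ?_⟩
  rw [(canonical l).runNat_eq_iff h.1]
  simp only [h.2, pow_succ 2 l, mul_two, glue_add]
  constructor
  · intro h z
    have := h z fun n => z (2 ^ l + n)
    rwa [glue_shift] at this
  · intro h z z'
    exact h _

theorem Realizes.bConnection {l m e : ℕ} {a : MockProto l m} {eb : Fin m → ℕ}
    {b : (j : Fin m) → MockProto l (eb j)} {bRet : (j : Fin m) → Fin (eb j) → Fin e}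
    {g : (ℕ → Bool) → Prop} (h : (grouping a id eb b bRet).Realizes g) (x : ℕ → Bool) :
    (b (a.runNat x)).Realizes fun q => g (glue (2 ^ l) x q) := by
  obtain ⟨-, hb, hi, -⟩ := isProto_grouping_iff.mp h.1
  refine ⟨hb _, fun y z => ?_⟩
  have := h.2 (glue (2 ^ l) x y) (glue (2 ^ l) x z)
  simp only [pow_succ 2 l, mul_two, glue_add, runNat_grouping_glue, (hi _).eq_iff] at this
  exact this

/-- The source of all lower bounds on vertices and edges: prefixes with pairwise different residuals
leave through different exits. -/
theorem Realizes.card_le {l e : ℕ} {P : MockProto l e} {g : (ℕ → Bool) → Prop}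
    (h : P.Realizes g) {W : Type*} [Fintype W] (u : W → ℕ → Bool)
    (hu : ∀ y y', (∀ z, g (glue (2 ^ l) (u y) z) ↔ g (glue (2 ^ l) (u y') z)) → y = y') :
    Fintype.card W ≤ e := by
  have := Fintype.card_le_of_injective (fun y => P.runNat (u y)) fun y y' hy =>
    hu y y' ((h.2 _ _).mp hy)
  rwa [Fintype.card_fin] at this

theorem self_mem_groupings {l e : ℕ} (P : MockProto l e) :
    (⟨l, e, P⟩ : Σ l : ℕ, Σ e : ℕ, MockProto l e) ∈ P.groupings := by
  cases P <;> simp [groupings]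

theorem groupings_aConnection_subset {l ea m e : ℕ} (a : MockProto l ea) (aRet : Fin ea → Fin m)
    (eb : Fin m → ℕ) (b : (j : Fin m) → MockProto l (eb j))
    (bRet : (j : Fin m) → Fin (eb j) → Fin e) :
    a.groupings ⊆ (grouping a aRet eb b bRet).groupings := by
  intro G hG
  simp [groupings, hG]

theorem groupings_bConnection_subset {l ea m e : ℕ} (a : MockProto l ea) (aRet : Fin ea → Fin m)
    (eb : Fin m → ℕ) (b : (j : Fin m) → MockProto l (eb j))
    (bRet : (j : Fin m) → Fin (eb j) → Fin e) (j : Fin m) :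
    (b j).groupings ⊆ (grouping a aRet eb b bRet).groupings := by
  intro G hG
  simp only [groupings, Finset.mem_insert, Finset.mem_union, Finset.mem_biUnion,
    Finset.mem_univ, true_and]
  exact Or.inr (Or.inr ⟨j, hG⟩)

theorem Realizes.exists_of_le {g : (ℕ → Bool) → Prop} {l' : ℕ} : ∀ {l e : ℕ} {P : MockProto l e},
    P.Realizes g → l' ≤ l → ∃ (e' : ℕ) (Q : MockProto l' e'), Q.Realizes g ∧
      (⟨l', e', Q⟩ : Σ l : ℕ, Σ e : ℕ, MockProto l e) ∈ P.groupings
  | l, e, P, h, hl => by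
    rcases hl.eq_or_lt with rfl | hlt
    · exact ⟨e, P, h, P.self_mem_groupings⟩
    · obtain ⟨l, rfl⟩ : ∃ i, l = i + 1 := ⟨l - 1, by omega⟩
      obtain ⟨m, a, eb, b, bRet, rfl⟩ := h.1.exists_eq_grouping
      obtain ⟨e', Q, hQ, hmem⟩ := h.aConnection.exists_of_le (by omega : l' ≤ l)
      exact ⟨e', Q, hQ, groupings_aConnection_subset _ _ _ _ _ hmem⟩

end MockProto

/-! ### Residuals of f_k after the first half -/

/-- The word `w`, extended by zeros. -/
def word {k : ℕ} (w : Fin k → Bool) : ℕ → Bool := fun n => if h : n < k then w ⟨n, h⟩ else false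

theorem forall_word_eq_iff {k : ℕ} {w w' : Fin k → Bool} :
    (∀ i < k, word w i = word w' i) ↔ w = w' := by
  constructor
  · intro h
    funext i
    simpa [word] using h i i.2
  · rintro rfl i _
    rfl

theorem exists_ne_ne {k : ℕ} (hk : 2 ≤ k) (w w' : Fin k → Bool) : ∃ w'', w'' ≠ w ∧ w'' ≠ w' := by
  have h4 : 2 ^ 2 ≤ 2 ^ k := Nat.pow_le_pow_right (by omega) hk
  obtain ⟨w'', -, h⟩ := Finset.exists_mem_notMem_of_card_lt_card
    (s := {w, w'}) (t := (Finset.univ : Finset (Fin k → Bool))) (by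
      have := Finset.card_le_two (a := w) (b := w')
      simp
      omega)
  simp only [Finset.mem_insert, Finset.mem_singleton, not_or] at h
  exact ⟨w'', h⟩

/-- The words `w` and `y` at the beginning and at the end of a block of length `N`. -/
def block {k : ℕ} (N : ℕ) (w y : Fin k → Bool) : ℕ → Bool :=
  fun n => if n < k then word w n else word y (n - (N - k))

/-- The residual of `f_(K + 4)` after a first half that ends with the word `w`. -/
def TightAfter (K : ℕ) (w : Fin (K + 4) → Bool) (p : ℕ → Bool) : Prop :=
  Tight K (glue (2 ^ (K + 3)) (fun n => word w (n - (2 ^ (K + 3) - (K + 4)))) p)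

theorem tightAfter_iff {K : ℕ} (hK : 3 ≤ K) (w : Fin (K + 4) → Bool) (p : ℕ → Bool) :
    TightAfter K w p ↔ (∀ i < K + 4, word w i = p i) ∧
      (∀ i < K + 4, p (2 * 2 ^ K - (K + 4) + i) = p (2 * 2 ^ K + i)) ∧
      (∀ i < K + 4, p (4 * 2 ^ K - (K + 4) + i) = p (4 * 2 ^ K + i)) := by
  have hn := add_four_le_two_pow hK
  have hp : 2 ^ (K + 3) = 8 * 2 ^ K := by
    rw [pow_add]
    omega
  have hIco : ∀ (c : ℕ) (Q : ℕ → Prop), K + 4 ≤ c → ((∀ i ∈ Finset.Ico (c - (K + 4)) c, Q i) ↔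
      ∀ i < K + 4, Q (c - (K + 4) + i)) := by
    intro c Q hc
    constructor
    · intro h i hi
      exact h _ (Finset.mem_Ico.mpr (by omega))
    · intro h i hi
      rw [Finset.mem_Ico] at hi
      have := h (i - (c - (K + 4))) (by omega)
      rwa [Nat.add_sub_cancel' hi.1] at this
  unfold TightAfter Tight tightPositions
  rw [Finset.forall_mem_union, Finset.forall_mem_union, hIco _ _ (by omega), hIco _ _ (by omega),
    hIco _ _ (by omega), hp, and_assoc]
  refine and_congr ?_ (and_congr ?_ ?_)
  · refine forall₂_congr fun i hi => ?_
    -- Before the last K + 4 places of the first half, truncated subtraction yields copies of the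
    -- first bit of `w`; no check reads them.
    rw [glue_of_lt _ _ (by omega), glue_of_le _ _ (by omega)]
    have h1 : 8 * 2 ^ K - (K + 4) + i - (8 * 2 ^ K - (K + 4)) = i := by omega
    have h2 : 8 * 2 ^ K - (K + 4) + i + (K + 4) - 8 * 2 ^ K = i := by omega
    rw [h1, h2]
  · refine forall₂_congr fun i hi => ?_
    rw [glue_of_le _ _ (by omega), glue_of_le _ _ (by omega)]
    have h1 : 10 * 2 ^ K - (K + 4) + i - 8 * 2 ^ K = 2 * 2 ^ K - (K + 4) + i := by omega
    have h2 : 10 * 2 ^ K - (K + 4) + i + (K + 4) - 8 * 2 ^ K = 2 * 2 ^ K + i := by omega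
    rw [h1, h2]
  · refine forall₂_congr fun i hi => ?_
    rw [glue_of_le _ _ (by omega), glue_of_le _ _ (by omega)]
    have h1 : 12 * 2 ^ K - (K + 4) + i - 8 * 2 ^ K = 4 * 2 ^ K - (K + 4) + i := by omega
    have h2 : 12 * 2 ^ K - (K + 4) + i + (K + 4) - 8 * 2 ^ K = 4 * 2 ^ K + i := by omega
    rw [h1, h2]

/-- The first block of length 2^(K+1) ends at depth 5/8 and the second at 3/4. The check at 1/2
holds by construction, so the other two can be violated independently. -/
theorem tightAfter_block_iff {K : ℕ} (hK : 3 ≤ K) (w y y' t t' : Fin (K + 4) → Bool) :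
    TightAfter K w (glue (2 ^ (K + 1)) (block (2 ^ (K + 1)) w y)
      (glue (2 ^ (K + 1)) (block (2 ^ (K + 1)) y' t) (word t'))) ↔ y = y' ∧ t = t' := by
  have hn := add_four_le_two_pow hK
  have hp : 2 ^ (K + 1) = 2 * 2 ^ K := by
    rw [pow_succ]
    omega
  rw [tightAfter_iff hK, hp, ← forall_word_eq_iff, ← forall_word_eq_iff]
  rw [and_iff_right]
  · refine and_congr ?_ ?_
    · refine forall₂_congr fun i hi => ?_
      rw [glue_of_lt _ _ (by omega), glue_of_le _ _ (by omega), glue_of_lt _ _ (by omega)]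
      simp only [block]
      rw [if_neg (by omega), if_pos (by omega), Nat.add_sub_cancel_left, Nat.add_sub_cancel_left]
    · refine forall₂_congr fun i hi => ?_
      rw [glue_of_le _ _ (by omega), glue_of_lt _ _ (by omega), glue_of_le _ _ (by omega),
        glue_of_le _ _ (by omega)]
      simp only [block]
      rw [if_neg (by omega)]
      have h1 : 4 * 2 ^ K - (K + 4) + i - 2 * 2 ^ K - (2 * 2 ^ K - (K + 4)) = i := by omega
      have h2 : 4 * 2 ^ K + i - 2 * 2 ^ K - 2 * 2 ^ K = i := by omega
      rw [h1, h2]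
  · intro i hi
    rw [glue_of_lt _ _ (by omega)]
    simp only [block]
    rw [if_pos hi]

open MockProto

/-- A grouping knows only a partition, not which class rejects, so a third word is needed. If w ≠
w', then after `w` the prefixes starting with w' and with w'' are both rejected for ever, hence
share an exit. After w' the former can be accepted and the latter cannot. The prefix read must
contain the whole word, hence `hl`. -/
theorem eq_of_realizes_tightAfter {K : ℕ} (hK : 3 ≤ K) {l e : ℕ} (hl : K + 4 ≤ 2 ^ l)
    {Q : MockProto l e} {w w' : Fin (K + 4) → Bool} (h : Q.Realizes (TightAfter K w))
    (h' : Q.Realizes (TightAfter K w')) : w = w' := by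
  by_contra hne
  obtain ⟨w'', h1, h2⟩ := exists_ne_ne (by omega) w w'
  set X := glue (2 ^ (K + 1)) (block (2 ^ (K + 1)) w' w')
      (glue (2 ^ (K + 1)) (block (2 ^ (K + 1)) w' w') (word w')) with hX
  have hX' : TightAfter K w' X := (tightAfter_block_iff hK w' w' w' w' w').mpr ⟨rfl, rfl⟩
  have hXw : ∀ i < K + 4, word w' i = X i := ((tightAfter_iff hK _ _).mp hX').1
  have hfail : ∀ v z, v ≠ w'' → ¬ TightAfter K v (glue (2 ^ l) (glue (K + 4) (word w'') X) z) := by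
    intro v z hv ht
    refine hv (forall_word_eq_iff.mp fun i hi => ?_)
    have := ((tightAfter_iff hK _ _).mp ht).1 i hi
    rwa [glue_of_lt _ _ (by omega), glue_of_lt _ _ hi] at this
  have hrun : Q.runNat X = Q.runNat (glue (K + 4) (word w'') X) := by
    refine (h.2 _ _).mpr fun z => iff_of_false (fun ht => hne ?_) (hfail w z h1.symm)
    refine forall_word_eq_iff.mp fun i hi => ?_
    have := ((tightAfter_iff hK _ _).mp ht).1 i hi
    rw [glue_of_lt _ _ (by omega)] at this
    rw [this, hXw i hi]
  have := ((h'.2 _ _).mp hrun) fun n => X (2 ^ l + n)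
  rw [glue_shift] at this
  exact hfail w' _ h2.symm (this.mp hX')

/-- The A-callee reads up to depth 3/4, where Y_2 = t has just been read and not yet been compared.
-/
theorem two_pow_le_headVertices {K : ℕ} (hK : 3 ≤ K) {e : ℕ} {Q : MockProto (K + 3) e}
    {w : Fin (K + 4) → Bool} (h : Q.Realizes (TightAfter K w)) : 2 ^ (K + 4) ≤ Q.headVertices := by
  obtain ⟨m, a, eb, b, bRet, rfl⟩ := h.1.exists_eq_grouping
  have hm := h.aConnection.card_le
    (fun t => glue (2 ^ (K + 1)) (block (2 ^ (K + 1)) w w) (block (2 ^ (K + 1)) w t)) (by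
      intro t t' ht
      have := ht (word t')
      rw [pow_succ 2 (K + 1), mul_two, glue_add, glue_add, tightAfter_block_iff hK,
        tightAfter_block_iff hK] at this
      exact (this.mpr ⟨rfl, rfl⟩).2)
  simp only [Fintype.card_pi, Fintype.card_bool, Finset.prod_const, Finset.card_univ,
    Fintype.card_fin] at hm
  simp only [headVertices]
  omega

/-- The halves meet at depth 5/8: the middle vertex remembers Y_1 = y, and after a matching Z_1 the
exits of its B-callee must separate all values t of Y_2. -/
theorem two_pow_le_headEdges {K : ℕ} (hK : 3 ≤ K) {e : ℕ} {Q : MockProto (K + 2) e}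
    {w : Fin (K + 4) → Bool} (h : Q.Realizes (TightAfter K w)) :
    2 ^ (K + 4) * 2 ^ (K + 4) ≤ Q.headEdges := by
  obtain ⟨m, a, eb, b, bRet, rfl⟩ := h.1.exists_eq_grouping
  have hb : ∀ y : Fin (K + 4) → Bool,
      2 ^ (K + 4) ≤ eb (a.runNat (block (2 ^ (K + 1)) w y)) := by
    intro y
    have := (h.bConnection (block (2 ^ (K + 1)) w y)).card_le
      (fun t => block (2 ^ (K + 1)) y t) (by
        intro t t' ht
        have := ht (word t')
        rw [tightAfter_block_iff hK, tightAfter_block_iff hK] at this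
        exact (this.mpr ⟨rfl, rfl⟩).2)
    simpa using this
  have ha : Function.Injective fun y => a.runNat (block (2 ^ (K + 1)) w y) := by
    intro y y' hy
    have := (h.aConnection.2 _ _).mp hy (glue (2 ^ (K + 1)) (block (2 ^ (K + 1)) y' w) (word w))
    rw [tightAfter_block_iff hK, tightAfter_block_iff hK] at this
    exact (this.mpr ⟨rfl, rfl⟩).1
  have hsum : 2 ^ (K + 4) * 2 ^ (K + 4) ≤ ∑ j, eb j := by
    calc 2 ^ (K + 4) * 2 ^ (K + 4) = ∑ _y : Fin (K + 4) → Bool, 2 ^ (K + 4) := by simp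
      _ ≤ ∑ y : Fin (K + 4) → Bool, eb (a.runNat (block (2 ^ (K + 1)) w y)) :=
          Finset.sum_le_sum fun y _ => hb y
      _ = ∑ j ∈ Finset.univ.map ⟨_, ha⟩, eb j := by simp
      _ ≤ _ := Finset.sum_le_sum_of_subset (Finset.subset_univ _)
  simp only [headEdges]
  omega

/-! ### Counting in the CFLOBDD for f_k -/

namespace CFLOBDD

theorem head_realizes_tight {K : ℕ} (hK : 3 ≤ K) {C : CFLOBDD Bool (K + 4)}
    (hC : C.Represents (tightFun (K + 4))) : C.head.Realizes (Tight K) := by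
  classical
  have h : ∀ x, C.value (C.head.runNat x) = decide (Tight K x) := by
    intro x
    rw [← tightFun_eq hK]
    exact hC _
  refine ⟨C.isProto, fun x y => ?_⟩
  -- The function reads no variable beyond the block, so continuations do not matter at the top
  -- level.
  have hz : ∀ x z, Tight K (glue (2 ^ (K + 4)) x z) ↔ Tight K x := by
    intro x z
    rw [← decide_eq_decide, ← h, ← h, runNat_glue]
  simp only [hz, forall_const]
  rw [← C.value_injective.eq_iff, h, h, decide_eq_decide]

/-- One B-call from the head, entered after `w`, and then A-calls down to level `l`. -/
theorem exists_realizes_tightAfter {K : ℕ} (hK : 3 ≤ K) {C : CFLOBDD Bool (K + 4)}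
    (hC : C.Represents (tightFun (K + 4))) {l : ℕ} (hl : l ≤ K + 3) (w : Fin (K + 4) → Bool) :
    ∃ (e : ℕ) (Q : MockProto l e), Q.Realizes (TightAfter K w) ∧
      (⟨l, e, Q⟩ : Σ l : ℕ, Σ e : ℕ, MockProto l e) ∈ C.head.groupings := by
  obtain ⟨m, a, eb, b, bRet, hP⟩ := C.isProto.exists_eq_grouping
  have hR := head_realizes_tight hK hC
  rw [hP] at hR ⊢
  obtain ⟨e, Q, hQ, hmem⟩ := (hR.bConnection
    fun n => word w (n - (2 ^ (K + 3) - (K + 4)))).exists_of_le hl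
  exact ⟨e, Q, hQ, groupings_bConnection_subset _ _ _ _ _ _ hmem⟩

theorem two_pow_mul_le_sum {K : ℕ} (hK : 3 ≤ K) {C : CFLOBDD Bool (K + 4)}
    (hC : C.Represents (tightFun (K + 4))) {l N : ℕ} (hl : l ≤ K + 3) (hl' : K ≤ l)
    (h : (Σ l : ℕ, Σ e : ℕ, MockProto l e) → ℕ) (hN : ∀ (e : ℕ) (Q : MockProto l e)
      (w : Fin (K + 4) → Bool), Q.Realizes (TightAfter K w) → N ≤ h ⟨l, e, Q⟩) :
    2 ^ (K + 4) * N ≤ ∑ G ∈ C.head.groupings, h G := by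
  have hn := (add_four_le_two_pow hK).trans (Nat.pow_le_pow_right (by omega) hl')
  choose e Q hQ hmem using exists_realizes_tightAfter hK hC hl
  let φ : (Fin (K + 4) → Bool) → Σ l : ℕ, Σ e : ℕ, MockProto l e := fun w => ⟨l, e w, Q w⟩
  have hφ : Function.Injective φ := by
    intro w w' hw
    have hw' := eq_of_heq (Sigma.mk.inj_iff.mp hw).2
    have key : ∀ p p' : Σ e, MockProto l e, p = p' → p.2.Realizes (TightAfter K w) →
        p'.2.Realizes (TightAfter K w') → w = w' := by
      rintro p _ rfl h1 h2
      exact eq_of_realizes_tightAfter hK hn h1 h2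
    exact key _ _ hw' (hQ w) (hQ w')
  calc 2 ^ (K + 4) * N = ∑ _w : Fin (K + 4) → Bool, N := by simp
    _ ≤ ∑ w, h (φ w) := Finset.sum_le_sum fun w _ => hN _ _ w (hQ w)
    _ = ∑ G ∈ Finset.univ.map ⟨φ, hφ⟩, h G := by simp
    _ ≤ _ := Finset.sum_le_sum_of_subset fun G hG => by
        obtain ⟨w, -, rfl⟩ := Finset.mem_map.mp hG
        exact hmem w

theorem le_numVertices {K : ℕ} (hK : 3 ≤ K) {C : CFLOBDD Bool (K + 4)}
    (hC : C.Represents (tightFun (K + 4))) : 2 ^ (K + 4) * 2 ^ (K + 4) ≤ C.numVertices :=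
  two_pow_mul_le_sum hK hC le_rfl (by omega) (fun G => G.2.2.headVertices)
    fun _ _ _ h => two_pow_le_headVertices hK h

theorem le_numEdges {K : ℕ} (hK : 3 ≤ K) {C : CFLOBDD Bool (K + 4)}
    (hC : C.Represents (tightFun (K + 4))) :
    2 ^ (K + 4) * (2 ^ (K + 4) * 2 ^ (K + 4)) ≤ C.numEdges :=
  two_pow_mul_le_sum hK hC (by omega : K + 2 ≤ K + 3) (by omega) (fun G => G.2.2.headEdges)
    fun _ _ _ h => two_pow_le_headEdges hK h

theorem add_four_le_two_pow_half {K : ℕ} (hK : 3 ≤ K) : K + 4 ≤ 2 ^ ((K + 4) / 2) := by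
  have h : ∀ i, 3 ≤ i → 2 * i + 1 ≤ 2 ^ i := by
    intro i hi
    induction i, hi using Nat.le_induction with
    | base => norm_num
    | succ i _ ih =>
      rw [pow_succ]
      omega
  have := h ((K + 4) / 2) (by omega)
  omega

theorem le_numGroupings {K : ℕ} (hK : 3 ≤ K) {C : CFLOBDD Bool (K + 4)}
    (hC : C.Represents (tightFun (K + 4))) :
    (K + 4) * 2 ^ (K + 4) ≤ 2 * C.numGroupings := by
  have hn := add_four_le_two_pow_half hK
  -- On these levels 2^l ≥ K + 4, and they are at least half of all K + 4 levels below the head;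
  -- hence the factor 2.
  let I := Finset.Icc ((K + 4) / 2) (K + 3)
  have hI : ∀ l : I, (l : ℕ) ≤ K + 3 := fun l => (Finset.mem_Icc.mp l.2).2
  have hI' : ∀ l : I, K + 4 ≤ 2 ^ (l : ℕ) := fun l =>
    hn.trans (Nat.pow_le_pow_right (by omega) (Finset.mem_Icc.mp l.2).1)
  choose e Q hQ hmem using fun l : I => exists_realizes_tightAfter hK hC (hI l)
  have hinj : Function.Injective fun p : I × (Fin (K + 4) → Bool) =>
      (⟨p.1, e p.1 p.2, Q p.1 p.2⟩ : Σ l : ℕ, Σ e : ℕ, MockProto l e) := by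
    rintro ⟨l, w⟩ ⟨l', w'⟩ h
    have key : ∀ G G' : Σ l : ℕ, Σ e : ℕ, MockProto l e, G = G' → K + 4 ≤ 2 ^ G.1 →
        G.2.2.Realizes (TightAfter K w) → G'.2.2.Realizes (TightAfter K w') →
        G.1 = G'.1 ∧ w = w' := by
      rintro G _ rfl hG h1 h2
      exact ⟨rfl, eq_of_realizes_tightAfter hK hG h1 h2⟩
    obtain ⟨h1, h2⟩ := key _ _ h (hI' l) (hQ l w) (hQ l' w')
    exact Prod.ext (Subtype.ext h1) h2
  have hcard := Finset.card_le_card_of_injOn (s := Finset.univ) (t := C.head.groupings) _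
    (fun p _ => hmem p.1 p.2) hinj.injOn
  simp only [Finset.card_univ, Fintype.card_prod, Fintype.card_coe, I, Nat.card_Icc,
    Fintype.card_pi, Fintype.card_bool, Finset.prod_const, Fintype.card_fin] at hcard
  calc (K + 4) * 2 ^ (K + 4) ≤ 2 * (K + 3 + 1 - (K + 4) / 2) * 2 ^ (K + 4) :=
        Nat.mul_le_mul_right _ (by omega)
    _ ≤ 2 * C.numGroupings := by
        rw [mul_assoc]
        exact Nat.mul_le_mul_left _ hcard

end CFLOBDD

end DD

theorem mainTheorem2 :
    -- the BDD and the CFLOBDD for `f_k` exist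
    (∀ k : ℕ, 7 ≤ k →
      (∃ B : DD.BDD Bool (2 ^ k), B.Represents (DD.tightFun k)) ∧
      (∃ C : DD.CFLOBDD Bool k, C.Represents (DD.tightFun k))) ∧
    -- the BDD has `Θ(2 ^ k)` nodes
    (∃ c₁ c₂ : ℝ, 0 < c₁ ∧ 0 < c₂ ∧
      ∀ k : ℕ, 7 ≤ k → ∀ B : DD.BDD Bool (2 ^ k), B.Represents (DD.tightFun k) →
        c₁ * 2 ^ k ≤ (B.size : ℝ) ∧ (B.size : ℝ) ≤ c₂ * 2 ^ k) ∧
    -- lower bounds on the numbers of groupings, vertices and edges of the CFLOBDD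
    (∃ c : ℝ, 0 < c ∧
      ∀ k : ℕ, 7 ≤ k →
        ∀ B : DD.BDD Bool (2 ^ k), B.Represents (DD.tightFun k) →
        ∀ C : DD.CFLOBDD Bool k, C.Represents (DD.tightFun k) →
          (c * (k * 2 ^ k) ≤ (C.numGroupings : ℝ) ∧
            c * (B.size * Real.logb 2 B.size) ≤ (C.numGroupings : ℝ)) ∧
          (c * 2 ^ (2 * k) ≤ (C.numVertices : ℝ) ∧
            c * (B.size : ℝ) ^ 2 ≤ (C.numVertices : ℝ)) ∧
          (c * 2 ^ (3 * k) ≤ (C.numEdges : ℝ) ∧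
            c * (B.size : ℝ) ^ 3 ≤ (C.numEdges : ℝ))) := by
  have hlow : ∀ (k : ℕ) (B : DD.BDD Bool (2 ^ k)), (2 : ℝ) ^ k ≤ B.size := fun k B => by
    exact_mod_cast B.lt_size.le
  have hupp : ∀ k : ℕ, 7 ≤ k → ∀ B : DD.BDD Bool (2 ^ k), B.Represents (DD.tightFun k) →
      (B.size : ℝ) ≤ 22 * 2 ^ k := by
    intro k hk B hB
    obtain ⟨K, rfl⟩ : ∃ K, k = K + 4 := ⟨k - 4, by omega⟩
    exact_mod_cast DD.BDD.size_le_of_represents_tightFun (by omega) hB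
  refine ⟨fun k _ => ⟨DD.BDD.exists_represents _, DD.CFLOBDD.exists_represents _⟩,
    ⟨1, 22, one_pos, by norm_num, fun k hk B hB => ⟨by simpa using hlow k B, hupp k hk B hB⟩⟩,
    -- The cubic bound needs 22^3. This exceeds 22^2 and also 88 = 2 · 44, the constant for |B|
    -- log|B|.
    1 / 22 ^ 3, by positivity, fun k hk B hB C hC => ?_⟩
  have h1 := hlow k B
  have h2 := hupp k hk B hB
  have hk' : (7 : ℝ) ≤ k := by exact_mod_cast hk
  obtain ⟨hG, hV, hE⟩ : (k : ℝ) * 2 ^ k ≤ 2 * C.numGroupings ∧ (2 : ℝ) ^ k * 2 ^ k ≤ C.numVertices ∧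
      (2 : ℝ) ^ k * (2 ^ k * 2 ^ k) ≤ C.numEdges := by
    obtain ⟨K, rfl⟩ : ∃ K, k = K + 4 := ⟨k - 4, by omega⟩
    exact ⟨by exact_mod_cast DD.CFLOBDD.le_numGroupings (by omega) hC,
      by exact_mod_cast DD.CFLOBDD.le_numVertices (by omega) hC,
      by exact_mod_cast DD.CFLOBDD.le_numEdges (by omega) hC⟩
  have hpos : (0 : ℝ) < 2 ^ k := by positivity
  have hlog : Real.logb 2 B.size ≤ 2 * k := by
    rw [Real.logb_le_iff_le_rpow (by norm_num) (hpos.trans_le h1)]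
    have h5 : (22 : ℝ) ≤ 2 ^ k :=
      le_trans (by norm_num) (pow_le_pow_right₀ (by norm_num : (1 : ℝ) ≤ 2) hk)
    calc (B.size : ℝ) ≤ 22 * 2 ^ k := h2
      _ ≤ 2 ^ k * 2 ^ k := by gcongr
      _ = 2 ^ ((2 : ℝ) * k) := by
        rw [← pow_add, ← two_mul, ← Real.rpow_natCast]
        push_cast
        rfl
  have hlog0 : 0 ≤ Real.logb 2 B.size :=
    Real.logb_nonneg (by norm_num) ((one_le_pow₀ (by norm_num)).trans h1)
  have hprod : (B.size : ℝ) * Real.logb 2 B.size ≤ 44 * (k * 2 ^ k) :=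
    (mul_le_mul h2 hlog hlog0 (by positivity)).trans_eq (by ring)
  have hsq : (B.size : ℝ) ^ 2 ≤ 22 ^ 2 * (2 ^ k * 2 ^ k) :=
    (pow_le_pow_left₀ (by positivity) h2 2).trans_eq (by ring)
  have hcu : (B.size : ℝ) ^ 3 ≤ 22 ^ 3 * (2 ^ k * (2 ^ k * 2 ^ k)) :=
    (pow_le_pow_left₀ (by positivity) h2 3).trans_eq (by ring)
  have e2 : (2 : ℝ) ^ (2 * k) = 2 ^ k * 2 ^ k := by rw [two_mul, pow_add]
  have e3 : (2 : ℝ) ^ (3 * k) = 2 ^ k * (2 ^ k * 2 ^ k) := by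
    rw [← pow_add, ← pow_add]
    congr 1
    omega
  rw [e2, e3]
  have p1 : (0 : ℝ) ≤ k * 2 ^ k := by positivity
  have p2 : (0 : ℝ) ≤ 2 ^ k * 2 ^ k := by positivity
  have p3 : (0 : ℝ) ≤ 2 ^ k * (2 ^ k * 2 ^ k) := by positivity
  refine ⟨⟨?_, ?_⟩, ⟨?_, ?_⟩, ⟨?_, ?_⟩⟩ <;> linarith
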